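/- Let $a,b\in\mathbb{R}$ with $0\le a\le 1/2$ and $a^2+b^2>1$, let $\Gamma_{a,b}=\mathbb{Z}(1,0)+\mathbb{Z}(a,b)$, and let $g_{a,b}$ be the flat metric on the torus $\mathbb{T}=\mathbb{R}^2/\Gamma_{a,b}$ induced by the Euclidean metric of $\mathbb{R}^2$. For a smooth Riemannian metric $h$ on $\mathbb{T}$ let $\lambda_1(h)$ be the first nontrivial (that is, the smallest positive) eigenvalue of the Laplace–Beltrami operator $\Delta_h$ acting on smooth functions, and put $\bar\lambda_1(h)=\lambda_1(h)\,\mathrm{Area}(\mathbb{T},h)$. Then $g_{a,b}$ is not a maximiser of $\bar\lambda_1$ in its conformal class $[g_{a,b}]=\{e^{2\omega}g_{a,b} : \omega\in C^\infty(\mathbb{T})\}$: there is $\omega\in C^\infty(\mathbb{T})$ with $$\bar\lambda_1(e^{2\omega}g_{a,b})>\bar\lambda_1(g_{a,b}).$$ -/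

import Mathlib

open MeasureTheory
open scoped ContDiff

noncomputable section

namespace FlatTorus

/-- The Euclidean plane. -/
abbrev Plane : Type := EuclideanSpace ℝ (Fin 2)

/-- The lattice `ℤ (1, 0) + ℤ (a, b)`. -/
def lattice (a b : ℝ) : AddSubgroup Plane :=
  AddSubgroup.closure {!₂[(1 : ℝ), 0], !₂[a, b]}

/-- The torus `ℝ² / (ℤ (1, 0) + ℤ (a, b))`. -/
abbrev Torus (a b : ℝ) : Type := Plane ⧸ lattice a b

variable {a b : ℝ}

/-- The lift to the plane of a function on the torus. -/
def lift (u : Torus a b → ℝ) : Plane → ℝ := fun p => u (QuotientAddGroup.mk p)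

/-- Smooth functions on the torus: the projection from the plane is a local diffeomorphism, so
smoothness on the torus is smoothness of the lift. -/
def IsSmooth (u : Torus a b → ℝ) : Prop := ContDiff ℝ ∞ (lift u)

/-- A smooth Riemannian metric on the torus, given by its coefficients `g_ij` with respect to
the global frame `∂₀, ∂₁` induced by the standard coordinates of the plane. -/
structure Metric (a b : ℝ) where
  coeff : Torus a b → Matrix (Fin 2) (Fin 2) ℝ
  posDef : ∀ x, (coeff x).PosDef
  smooth : ∀ i j, IsSmooth (fun x => coeff x i j)

/-- The flat metric `g_{a,b}` on the torus induced by the Euclidean metric of the plane. -/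
def flatMetric (a b : ℝ) : Metric a b where
  coeff := fun _ => 1
  posDef := fun _ => Matrix.PosDef.one
  smooth := fun _ _ => contDiff_const

/-- The conformal class `[g] = {e^{2w} g | w ∈ C^∞}`. -/
def conformalClass (g : Metric a b) : Set (Metric a b) :=
  {h | ∃ w : Torus a b → ℝ, IsSmooth w ∧ ∀ x, h.coeff x = Real.exp (2 * w x) • g.coeff x}

/-- The partial derivative `∂_i f` of a function on the plane. -/
def partialDeriv (i : Fin 2) (f : Plane → ℝ) (p : Plane) : ℝ :=
  fderiv ℝ f p (EuclideanSpace.single i 1)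

/-- The Riemannian density `√(det g)`, lifted to the plane. -/
def density (g : Metric a b) : Plane → ℝ :=
  lift fun x => Real.sqrt (g.coeff x).det

/-- The (nonnegative) Laplace-Beltrami operator
`Δ_g u = - (1 / √(det g)) ∑ i j, ∂_i (√(det g) g^{ij} ∂_j u)`, lifted to the plane. -/
def laplacian (g : Metric a b) (u : Torus a b → ℝ) (p : Plane) : ℝ :=
  -(1 / density g p) * ∑ i, ∑ j, partialDeriv i
    (fun q => density g q * lift (fun x => (g.coeff x)⁻¹ i j) q * partialDeriv j (lift u) q) p

/-- `μ` is an eigenvalue of the Laplace-Beltrami operator of `g`. -/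
def IsEigenvalue (g : Metric a b) (μ : ℝ) : Prop :=
  ∃ u : Torus a b → ℝ, IsSmooth u ∧ u ≠ 0 ∧ ∀ p : Plane, laplacian g u p = μ * lift u p

/-- The first nontrivial eigenvalue `λ₁(g)`. As the torus is connected, `λ₀(g) = 0` is simple,
so `λ₁(g)` is the smallest positive eigenvalue. -/
def lambdaOne (g : Metric a b) : ℝ := sInf {μ : ℝ | 0 < μ ∧ IsEigenvalue g μ}

/-- The parallelogram spanned by `(1, 0)` and `(a, b)`, a fundamental domain of the lattice. -/
def fundamentalParallelogram (a b : ℝ) : Set Plane :=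
  {p | ∃ s ∈ Set.Ico (0 : ℝ) 1, ∃ t ∈ Set.Ico (0 : ℝ) 1,
    p = s • !₂[(1 : ℝ), 0] + t • !₂[a, b]}

/-- The area of the torus with the metric `g`. -/
def area (g : Metric a b) : ℝ := ∫ p in fundamentalParallelogram a b, density g p

/-- The normalised first eigenvalue `λ₁(g) · Area(g)`. -/
def lambdaBarOne (g : Metric a b) : ℝ := lambdaOne g * area g

/-- `g` maximises `λ₁ · Area` within its conformal class. -/
def IsConformallyMaximal (g : Metric a b) : Prop :=
  ∀ h ∈ conformalClass g, lambdaBarOne h ≤ lambdaBarOne g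

end FlatTorus

end

/-! The flat metric is beaten by a conformal factor that depends only on the height `t = 2πy/b`: one
that keeps `(2π/b)²` as first eigenvalue but strictly increases the area.

For functions of `t` alone the eigenvalue equation becomes the periodic Hill problem `w'' = -ν p w`,
with `p` the conformal factor and `ν = (b/2π)² μ`. Take `p = (f')² + S(f)/2`, where `f(t) = t + ε
sin t` and `S` is the Schwarzian derivative; this is `profile`. Changing variables by `f` turns `w''
= -w` into `w'' = -p w`, so `cos f / √f'` is a periodic solution and `ν = 1` is an eigenvalue.
Wirtinger's inequality transported by `f` makes the form `∫ z'² - p z²` nonnegative on a hyperplane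
(`hillForm_nonneg`). An eigenvalue `ν` in `(0, 1)` would make it negative definite on the plane
spanned by `w` and `1`, which meets the hyperplane (`hill_eq_zero`).

The modes depending on `x` cause no trouble. In the flat metric their eigenvalues are `(2π/b)² (m²b²
+ (n - ma)²)` with `m ≠ 0`, and `a² + b² > 1` keeps these uniformly above `(2π/b)²` (`dual_gap`).
For small `ε` the bound `p ≤ 1 + 4ε` preserves this separation (`quasiPeriodic_hill_eq_zero`).
Fourier expansion in `x` combines the two cases in `eq_zero_of_pde`.

The area is proportional to `∫ p`, which exceeds its flat value `2π` at second order in `ε`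
(`integral_profile_gt`). -/

noncomputable section

namespace FlatTorus

/-! ### Fourier series and Wirtinger inequalities -/

open Set Complex in
lemma fourierCoeffOn_eq_integral_exp {T : ℝ} (hT : 0 < T) (f : ℝ → ℂ) (n : ℤ) :
    fourierCoeffOn hT f n =
      (T : ℂ)⁻¹ * ∫ y in (0 : ℝ)..T, cexp (((-(2 * Real.pi * n / T * y) : ℝ) : ℂ) * I) * f y := by
  rw [fourierCoeffOn_eq_integral]
  simp only [sub_zero, one_div, real_smul, ofReal_inv, smul_eq_mul]
  congr 1
  refine intervalIntegral.integral_congr fun y _ => ?_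
  simp only [fourier_coe_apply]
  congr 2
  push_cast
  ring

/-- Parseval's identity for the Fourier coefficients twisted by the character `y ↦ e^{iβy/T}`. -/
lemma hasSum_sq_norm_twisted {T : ℝ} (hT : 0 < T) (β : ℝ) {g : ℝ → ℂ} (hg : Continuous g) :
    HasSum (fun n : ℤ => ‖∫ y in (0 : ℝ)..T,
        Complex.exp (((-((2 * Real.pi * n + β) / T * y) : ℝ) : ℂ) * Complex.I) * g y‖ ^ 2)
      (T * ∫ y in (0 : ℝ)..T, ‖g y‖ ^ 2) := by
  set p : ℝ → ℂ := fun y => Complex.exp (((-(β / T * y) : ℝ) : ℂ) * Complex.I) * g y with hp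
  have hpc : Continuous p := by fun_prop
  have hmem : MemLp p 2 (volume.restrict (Set.Ioc 0 T)) := by
    obtain ⟨C, hC⟩ :=
      (isCompact_Icc (a := (0 : ℝ)) (b := T)).exists_bound_of_continuousOn hpc.continuousOn
    exact MemLp.of_bound hpc.aestronglyMeasurable C
      ((ae_restrict_iff' measurableSet_Ioc).2
        (Filter.Eventually.of_forall fun y hy => hC y (Set.Ioc_subset_Icc_self hy)))
  have h := (hasSum_sq_fourierCoeffOn hT hmem).mul_left (T ^ 2)
  have e1 : ∀ n : ℤ, ‖∫ y in (0 : ℝ)..T,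
      Complex.exp (((-((2 * Real.pi * n + β) / T * y) : ℝ) : ℂ) * Complex.I) * g y‖ ^ 2 =
      T ^ 2 * ‖fourierCoeffOn hT p n‖ ^ 2 := by
    intro n
    rw [fourierCoeffOn_eq_integral_exp, norm_mul, mul_pow, norm_inv, Complex.norm_real,
      Real.norm_of_nonneg hT.le, ← mul_assoc, ← mul_pow, mul_inv_cancel₀ hT.ne', one_pow, one_mul]
    congr 2
    refine intervalIntegral.integral_congr fun y _ => ?_
    simp only [hp]
    rw [← mul_assoc, ← Complex.exp_add]
    congr 2
    push_cast
    ring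
  have e2 : T * ∫ y in (0 : ℝ)..T, ‖g y‖ ^ 2 =
      T ^ 2 * (T - 0)⁻¹ • ∫ y in (0 : ℝ)..T, ‖p y‖ ^ 2 := by
    simp only [sub_zero, smul_eq_mul, hp, norm_mul, Complex.norm_exp_ofReal_mul_I, one_mul]
    field_simp
  simp only [e1, e2]
  exact h

/-- Integration by parts: the frequencies `(2πn + β)/T` are those whose exponential undoes the phase
`e^{iβ}` over a period, so the boundary contributions reduce to `g 0 - g 0`. -/
lemma integral_twisted_deriv {T : ℝ} (hT : 0 < T) (β : ℝ) {g g' : ℝ → ℂ}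
    (hg : ∀ y, HasDerivAt g (g' y) y) (hg' : Continuous g')
    (hper : g T = Complex.exp ((β : ℂ) * Complex.I) * g 0) (n : ℤ) :
    ∫ y in (0 : ℝ)..T,
        Complex.exp (((-((2 * Real.pi * n + β) / T * y) : ℝ) : ℂ) * Complex.I) * g' y =
      ((((2 * Real.pi * n + β) / T : ℝ) : ℂ) * Complex.I) * ∫ y in (0 : ℝ)..T,
        Complex.exp (((-((2 * Real.pi * n + β) / T * y) : ℝ) : ℂ) * Complex.I) * g y := by
  set k : ℝ := (2 * Real.pi * n + β) / T with hk
  have hgc : Continuous g := continuous_iff_continuousAt.2 fun y => (hg y).continuousAt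
  have hE : ∀ y : ℝ, HasDerivAt (fun y : ℝ => Complex.exp (((-(k * y) : ℝ) : ℂ) * Complex.I))
      (Complex.exp (((-(k * y) : ℝ) : ℂ) * Complex.I) * (-(k : ℂ) * Complex.I)) y := by
    intro y
    refine HasDerivAt.cexp ?_
    refine HasDerivAt.mul_const ?_ _
    have : HasDerivAt (fun y : ℝ => -(k * y)) (-k) y := by
      simpa using ((hasDerivAt_id' y).const_mul k).fun_neg
    simpa using this.ofReal_comp
  have h := intervalIntegral.integral_mul_deriv_eq_deriv_mul (a := 0) (b := T)
    (fun y _ => hE y) (fun y _ => hg y)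
    (Continuous.intervalIntegrable (by fun_prop) _ _) (hg'.intervalIntegrable _ _)
  rw [h, hper]
  have hphase : Complex.exp (((-(k * T) : ℝ) : ℂ) * Complex.I) *
      Complex.exp ((β : ℂ) * Complex.I) = 1 := by
    rw [← Complex.exp_add, Complex.exp_eq_one_iff]
    refine ⟨-n, ?_⟩
    have : k * T = 2 * Real.pi * n + β := by rw [hk]; field_simp
    rw [this]
    push_cast
    ring
  rw [← mul_assoc, hphase, ← intervalIntegral.integral_const_mul]
  simp only [mul_zero, neg_zero, Complex.ofReal_zero, zero_mul, Complex.exp_zero, sub_self,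
    zero_sub, ← intervalIntegral.integral_neg]
  exact intervalIntegral.integral_congr fun y _ => by ring

/-- Wirtinger's inequality for quasi-periodic functions. -/
theorem wirtinger_quasiPeriodic {T : ℝ} (hT : 0 < T) (β K : ℝ) {g g' : ℝ → ℂ}
    (hg : ∀ y, HasDerivAt g (g' y) y) (hg' : Continuous g')
    (hper : g T = Complex.exp ((β : ℂ) * Complex.I) * g 0)
    (hK : ∀ n : ℤ, K ≤ (2 * Real.pi * n + β) ^ 2 ∨ ∫ y in (0 : ℝ)..T,
      Complex.exp (((-((2 * Real.pi * n + β) / T * y) : ℝ) : ℂ) * Complex.I) * g y = 0) :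
    K * ∫ y in (0 : ℝ)..T, ‖g y‖ ^ 2 ≤ T ^ 2 * ∫ y in (0 : ℝ)..T, ‖g' y‖ ^ 2 := by
  have hgc : Continuous g := continuous_iff_continuousAt.2 fun y => (hg y).continuousAt
  have h1 := (hasSum_sq_norm_twisted hT β hgc).mul_left K
  have h2 := (hasSum_sq_norm_twisted hT β hg').mul_left (T ^ 2)
  -- Parseval reduces the claim to a termwise comparison: differentiation multiplies the `n`-th
  -- coefficient by `i(2πn + β)/T`.
  have h3 := hasSum_le (fun n => ?_) h1 h2
  · have : T * (K * ∫ y in (0 : ℝ)..T, ‖g y‖ ^ 2) ≤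
        T * (T ^ 2 * ∫ y in (0 : ℝ)..T, ‖g' y‖ ^ 2) := by linarith
    exact le_of_mul_le_mul_left this hT
  · rw [integral_twisted_deriv hT β hg hg' hper n]
    rcases hK n with h | h
    · rw [norm_mul, norm_mul, Complex.norm_I, mul_one, Complex.norm_real, mul_pow,
        Real.norm_eq_abs, sq_abs, div_pow, ← mul_assoc, mul_div_cancel₀ _ (by positivity)]
      exact mul_le_mul_of_nonneg_right h (by positivity)
    · rw [h]
      simp

/-- Wirtinger's inequality for `2π`-periodic functions of mean zero. -/
theorem wirtinger_of_integral_eq_zero {f f' : ℝ → ℝ} (hf : ∀ t, HasDerivAt f (f' t) t)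
    (hf' : Continuous f') (hper : f (2 * Real.pi) = f 0)
    (hmean : ∫ t in (0 : ℝ)..2 * Real.pi, f t = 0) :
    ∫ t in (0 : ℝ)..2 * Real.pi, f t ^ 2 ≤ ∫ t in (0 : ℝ)..2 * Real.pi, f' t ^ 2 := by
  have hpos : 0 < 2 * Real.pi := by positivity
  have h := wirtinger_quasiPeriodic hpos 0 ((2 * Real.pi) ^ 2) (g := fun t => (f t : ℂ))
    (g' := fun t => (f' t : ℂ)) (fun t => (hf t).ofReal_comp) (by fun_prop) (by simp [hper]) ?_
  · simp only [Complex.norm_real, Real.norm_eq_abs, sq_abs] at h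
    exact le_of_mul_le_mul_left h (by positivity)
  · intro n
    rcases eq_or_ne n 0 with rfl | hn
    · right
      simp [intervalIntegral.integral_ofReal, hmean]
    · left
      have : (1 : ℝ) ≤ (n : ℝ) ^ 2 := by
        have : (1 : ℤ) ≤ n ^ 2 := by have := sq_nonneg n; have := pow_ne_zero 2 hn; omega
        exact_mod_cast this
      rw [add_zero, mul_pow]
      nlinarith [sq_nonneg (2 * Real.pi)]

/-- A continuous function on an interval whose Fourier coefficients vanish is zero. -/
lemma integral_sq_norm_eq_zero_of_fourier {T : ℝ} (hT : 0 < T) {g : ℝ → ℂ} (hg : Continuous g)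
    (h : ∀ n : ℤ, ∫ y in (0 : ℝ)..T,
      Complex.exp (((-(2 * Real.pi * n / T * y) : ℝ) : ℂ) * Complex.I) * g y = 0) :
    ∫ y in (0 : ℝ)..T, ‖g y‖ ^ 2 = 0 := by
  have h1 := hasSum_sq_norm_twisted hT 0 hg
  simp only [add_zero, h, norm_zero] at h1
  have := h1.tsum_eq
  simpa [hT.ne', eq_comm] using this

/-- Periodicity allows the period interval to start at `y`, which gives the conclusion at every real
point. -/
lemma eq_zero_of_integral_eq_zero {T : ℝ} (hT : 0 < T) {f : ℝ → ℝ} (hf : Continuous f)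
    (h0 : ∀ y, 0 ≤ f y) (hper : Function.Periodic f T) (h : ∫ y in (0 : ℝ)..T, f y = 0) (y : ℝ) :
    f y = 0 := by
  by_contra hne
  have h1 : ∫ z in y..y + T, f z = 0 := by
    rw [hper.intervalIntegral_add_eq y 0, zero_add, h]
  have h2 := intervalIntegral.integral_pos (a := y) (b := y + T) (by linarith) hf.continuousOn
    (fun z _ => h0 z) ⟨y, ⟨le_rfl, by linarith⟩, lt_of_le_of_ne (h0 y) (Ne.symm hne)⟩
  linarith

/-- Differentiation under the integral sign for jointly continuous data. -/
lemma hasDerivAt_integral_of_continuous {F F' : ℝ → ℝ → ℂ} (l r : ℝ)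
    (hF : ∀ y, Continuous (F y)) (hF' : Continuous (Function.uncurry F'))
    (hd : ∀ y x, HasDerivAt (fun y => F y x) (F' y x) y) (y : ℝ) :
    HasDerivAt (fun y => ∫ x in l..r, F y x) (∫ x in l..r, F' y x) y := by
  obtain ⟨C, hC⟩ := ((isCompact_Icc (a := y - 1) (b := y + 1)).prod
    (isCompact_uIcc (a := l) (b := r))).exists_bound_of_continuousOn hF'.continuousOn
  refine (intervalIntegral.hasDerivAt_integral_of_dominated_loc_of_deriv_le
    (bound := fun _ => C) (Icc_mem_nhds (a := y - 1) (b := y + 1) (by linarith) (by linarith))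
    (Filter.Eventually.of_forall fun z => (hF z).aestronglyMeasurable)
    ((hF y).intervalIntegrable _ _) ?_ ?_ (by simp) ?_).2
  · exact (hF'.comp (by fun_prop : Continuous fun x : ℝ => (y, x))).aestronglyMeasurable
  · exact Filter.Eventually.of_forall fun x hx z hz =>
      hC (z, x) ⟨hz, Set.uIoc_subset_uIcc hx⟩
  · exact Filter.Eventually.of_forall fun x _ z _ => hd z x


/-! ### The circle diffeomorphism and its Hill potential -/

/-- The circle diffeomorphism `t ↦ t + ε sin t`. -/
def circleDiffeo (ε t : ℝ) : ℝ := t + ε * Real.sin t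

/-- The derivative of `circleDiffeo`. -/
def diffeoDeriv (ε t : ℝ) : ℝ := 1 + ε * Real.cos t

/-- The logarithmic derivative of `diffeoDeriv`. -/
def logDeriv₁ (ε t : ℝ) : ℝ := -(ε * Real.sin t) / diffeoDeriv ε t

/-- The derivative of `logDeriv₁`. -/
def logDeriv₂ (ε t : ℝ) : ℝ :=
  (-(ε * Real.cos t) * diffeoDeriv ε t - ε ^ 2 * Real.sin t ^ 2) / diffeoDeriv ε t ^ 2

/-- The potential of the Hill operator whose projective solutions are `tan ∘ circleDiffeo`. -/
def profile (ε t : ℝ) : ℝ := diffeoDeriv ε t ^ 2 + logDeriv₂ ε t / 2 - logDeriv₁ ε t ^ 2 / 4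

section Profile

variable {ε : ℝ}

lemma diffeoDeriv_ge (h0 : 0 ≤ ε) (t : ℝ) : 1 - ε ≤ diffeoDeriv ε t := by
  unfold diffeoDeriv; nlinarith [Real.neg_one_le_cos t]

lemma diffeoDeriv_le (h0 : 0 ≤ ε) (t : ℝ) : diffeoDeriv ε t ≤ 1 + ε := by
  unfold diffeoDeriv; nlinarith [Real.cos_le_one t]

lemma diffeoDeriv_pos (h0 : 0 ≤ ε) (h1 : ε < 1) (t : ℝ) : 0 < diffeoDeriv ε t := by
  linarith [diffeoDeriv_ge h0 t]

lemma circleDiffeo_two_pi : circleDiffeo ε (2 * Real.pi) = 2 * Real.pi := by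
  simp [circleDiffeo]

lemma circleDiffeo_zero : circleDiffeo ε 0 = 0 := by
  simp [circleDiffeo]

lemma circleDiffeo_add_two_pi (t : ℝ) :
    circleDiffeo ε (t + 2 * Real.pi) = circleDiffeo ε t + 2 * Real.pi := by
  simp [circleDiffeo]; ring

lemma periodic_diffeoDeriv : Function.Periodic (diffeoDeriv ε) (2 * Real.pi) := fun t => by
  simp [diffeoDeriv]

lemma periodic_logDeriv₁ : Function.Periodic (logDeriv₁ ε) (2 * Real.pi) := fun t => by
  simp [logDeriv₁, periodic_diffeoDeriv t]

lemma periodic_profile : Function.Periodic (profile ε) (2 * Real.pi) := fun t => by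
  simp [profile, logDeriv₁, logDeriv₂, periodic_diffeoDeriv t]

lemma hasDerivAt_circleDiffeo (t : ℝ) : HasDerivAt (circleDiffeo ε) (diffeoDeriv ε t) t :=
  (hasDerivAt_id' t).add ((Real.hasDerivAt_sin t).const_mul ε)

lemma contDiff_circleDiffeo {n : WithTop ℕ∞} : ContDiff ℝ n (circleDiffeo ε) := by
  unfold circleDiffeo; fun_prop

lemma contDiff_diffeoDeriv {n : WithTop ℕ∞} : ContDiff ℝ n (diffeoDeriv ε) := by
  unfold diffeoDeriv; fun_prop

lemma contDiff_logDeriv₁ (h0 : 0 ≤ ε) (h1 : ε < 1) {n : WithTop ℕ∞} :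
    ContDiff ℝ n (logDeriv₁ ε) := by
  unfold logDeriv₁
  exact ContDiff.div (by fun_prop) contDiff_diffeoDeriv fun t => (diffeoDeriv_pos h0 h1 t).ne'

lemma contDiff_logDeriv₂ (h0 : 0 ≤ ε) (h1 : ε < 1) {n : WithTop ℕ∞} :
    ContDiff ℝ n (logDeriv₂ ε) := by
  unfold logDeriv₂
  have := contDiff_diffeoDeriv (ε := ε) (n := n)
  exact ContDiff.div (by fun_prop) (by fun_prop)
    fun t => (pow_pos (diffeoDeriv_pos h0 h1 t) 2).ne'

lemma contDiff_profile (h0 : 0 ≤ ε) (h1 : ε < 1) {n : WithTop ℕ∞} :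
    ContDiff ℝ n (profile ε) := by
  unfold profile
  have := contDiff_diffeoDeriv (ε := ε) (n := n)
  have := contDiff_logDeriv₁ h0 h1 (n := n)
  have := contDiff_logDeriv₂ h0 h1 (n := n)
  fun_prop

lemma hasDerivAt_diffeoDeriv (h0 : 0 ≤ ε) (h1 : ε < 1) (t : ℝ) :
    HasDerivAt (diffeoDeriv ε) (logDeriv₁ ε t * diffeoDeriv ε t) t := by
  have h := ((Real.hasDerivAt_cos t).const_mul ε).const_add 1
  rw [logDeriv₁, div_mul_cancel₀ _ (diffeoDeriv_pos h0 h1 t).ne']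
  refine HasDerivAt.congr_deriv (h) ?_
  ring

lemma hasDerivAt_logDeriv₁ (h0 : 0 ≤ ε) (h1 : ε < 1) (t : ℝ) :
    HasDerivAt (logDeriv₁ ε) (logDeriv₂ ε t) t := by
  have hD := (diffeoDeriv_pos h0 h1 t).ne'
  have h := ((Real.hasDerivAt_sin t).const_mul ε).fun_neg.div (hasDerivAt_diffeoDeriv h0 h1 t) hD
  refine HasDerivAt.congr_deriv (h) ?_
  rw [logDeriv₂, logDeriv₁, div_mul_cancel₀ _ hD]
  ring

lemma hasDerivAt_sqrt_diffeoDeriv (h0 : 0 ≤ ε) (h1 : ε < 1) (t : ℝ) :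
    HasDerivAt (fun t => √(diffeoDeriv ε t))
      (√(diffeoDeriv ε t) * (logDeriv₁ ε t / 2)) t := by
  have hD := diffeoDeriv_pos h0 h1 t
  refine HasDerivAt.congr_deriv ((hasDerivAt_diffeoDeriv h0 h1 t).sqrt hD.ne') ?_
  have := Real.sqrt_pos.2 hD
  field_simp
  rw [Real.sq_sqrt hD.le, mul_comm]

lemma logDeriv₁_sq_le (h0 : 0 ≤ ε) (h1 : ε ≤ 1 / 10) (t : ℝ) :
    logDeriv₁ ε t ^ 2 ≤ 4 / 3 * ε ^ 2 := by
  have hD := diffeoDeriv_ge h0 t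
  rw [logDeriv₁, div_pow, div_le_iff₀ (by nlinarith)]
  have h2 : (81 : ℝ) / 100 ≤ diffeoDeriv ε t ^ 2 := by nlinarith
  nlinarith [Real.sin_sq_le_one t, sq_nonneg ε, mul_nonneg (sq_nonneg ε) (sub_nonneg.2 h2),
    mul_nonneg (sq_nonneg ε) (sub_nonneg.2 (Real.sin_sq_le_one t))]

/-- Substituting `s' = -ε cos t / f' - s²`, with `s = f''/f'`, leaves only terms with easy pointwise
bounds. -/
lemma profile_eq (h0 : 0 ≤ ε) (h1 : ε < 1) (t : ℝ) :
    profile ε t = diffeoDeriv ε t ^ 2 - ε * Real.cos t / (2 * diffeoDeriv ε t) -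
      3 / 4 * logDeriv₁ ε t ^ 2 := by
  have hD := (diffeoDeriv_pos h0 h1 t).ne'
  rw [profile, logDeriv₂, logDeriv₁]
  field_simp
  ring

lemma abs_mul_cos_div_le (h0 : 0 ≤ ε) (h1 : ε ≤ 1 / 10) (t : ℝ) :
    |ε * Real.cos t / (2 * diffeoDeriv ε t)| ≤ 5 / 9 * ε := by
  have hD := diffeoDeriv_ge h0 t
  have hc := Real.abs_cos_le_one t
  rw [abs_div, abs_mul, abs_of_nonneg h0, abs_of_pos (by linarith : 0 < 2 * diffeoDeriv ε t),
    div_le_iff₀ (by linarith)]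
  nlinarith

/-- Positivity is what allows the profile to be written as `e^{2w}`. -/
lemma profile_pos (h0 : 0 ≤ ε) (h1 : ε ≤ 1 / 10) (t : ℝ) : 0 < profile ε t := by
  rw [profile_eq h0 (by linarith)]
  have h2 := diffeoDeriv_ge h0 t
  have h3 := (abs_le.1 (abs_mul_cos_div_le h0 h1 t)).2
  have h4 := logDeriv₁_sq_le h0 h1 t
  nlinarith

lemma profile_le (h0 : 0 ≤ ε) (h1 : ε ≤ 1 / 10) (t : ℝ) : profile ε t ≤ 1 + 4 * ε := by
  rw [profile_eq h0 (by linarith)]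
  have h2 := diffeoDeriv_le h0 t
  have h2' := diffeoDeriv_ge h0 t
  have h3 := (abs_le.1 (abs_mul_cos_div_le h0 h1 t)).1
  have h4 := sq_nonneg (logDeriv₁ ε t)
  nlinarith

/-- With `s = f''/f'`, over a period `(f')²` contributes `2π + πε²`, the derivative `s'/2`
contributes nothing, and `s²/4 ≤ ε²/3` costs at most `2πε²/3`; the net gain is at least `πε²/3`. -/
lemma integral_profile_gt (h0 : 0 < ε) (h1 : ε ≤ 1 / 10) :
    2 * Real.pi < ∫ t in (0 : ℝ)..2 * Real.pi, profile ε t := by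
  have hε : ε < 1 := by linarith
  have hG : ∀ t, HasDerivAt
      (fun t => t + 2 * ε * Real.sin t + ε ^ 2 * (t + Real.sin t * Real.cos t) / 2 +
        logDeriv₁ ε t / 2 - ε ^ 2 * t / 3)
      (diffeoDeriv ε t ^ 2 + logDeriv₂ ε t / 2 - ε ^ 2 / 3) t := by
    intro t
    have hsc := (Real.hasDerivAt_sin t).mul (Real.hasDerivAt_cos t)
    have h := ((((hasDerivAt_id' t).add ((Real.hasDerivAt_sin t).const_mul (2 * ε))).add
      ((((hasDerivAt_id' t).add hsc).const_mul (ε ^ 2)).div_const 2)).add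
      ((hasDerivAt_logDeriv₁ h0.le hε t).div_const 2)).sub
      (((hasDerivAt_id' t).const_mul (ε ^ 2)).div_const 3)
    refine HasDerivAt.congr_deriv (h) ?_
    rw [diffeoDeriv]
    have := Real.sin_sq_add_cos_sq t
    linear_combination (-ε ^ 2 / 2) * this
  have hc : Continuous fun t => diffeoDeriv ε t ^ 2 + logDeriv₂ ε t / 2 - ε ^ 2 / 3 := by
    have := (contDiff_diffeoDeriv (ε := ε) (n := 0)).continuous
    have := (contDiff_logDeriv₂ h0.le hε (n := 0)).continuous
    fun_prop
  have hint := intervalIntegral.integral_eq_sub_of_hasDerivAt (a := 0) (b := 2 * Real.pi)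
    (fun t _ => hG t) (hc.intervalIntegrable _ _)
  have hle : ∫ t in (0 : ℝ)..2 * Real.pi, (diffeoDeriv ε t ^ 2 + logDeriv₂ ε t / 2 - ε ^ 2 / 3) ≤
      ∫ t in (0 : ℝ)..2 * Real.pi, profile ε t := by
    refine intervalIntegral.integral_mono_on (by positivity) (hc.intervalIntegrable _ _)
      ((contDiff_profile h0.le hε (n := 0)).continuous.intervalIntegrable _ _) fun t _ => ?_
    have := logDeriv₁_sq_le h0.le h1 t
    rw [profile]
    linarith
  rw [hint] at hle
  simp only [Real.sin_two_pi, Real.cos_two_pi, Real.sin_zero, Real.cos_zero, logDeriv₁] at hle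
  norm_num at hle
  have := mul_pos (pow_pos h0 2) Real.pi_pos
  linarith

/-! ### Spectral gap of the periodic Hill problem -/

lemma strictMono_circleDiffeo (h0 : 0 ≤ ε) (h1 : ε < 1) : StrictMono (circleDiffeo ε) :=
  strictMono_of_deriv_pos fun t => by
    rw [(hasDerivAt_circleDiffeo t).deriv]
    exact diffeoDeriv_pos h0 h1 t

lemma surjective_circleDiffeo (h0 : 0 ≤ ε) : Function.Surjective (circleDiffeo ε) := by
  refine (contDiff_circleDiffeo (n := 0)).continuous.surjective ?_ ?_
  · refine Filter.tendsto_atTop_mono (f := fun t => t + -ε) (fun t => ?_)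
      (Filter.tendsto_atTop_add_const_right _ _ Filter.tendsto_id)
    simp only [circleDiffeo]
    nlinarith [Real.neg_one_le_sin t]
  · refine Filter.tendsto_atBot_mono (g := circleDiffeo ε) (f := fun t => t + ε) (fun t => ?_)
      (Filter.tendsto_atBot_add_const_right _ _ Filter.tendsto_id)
    simp only [circleDiffeo]
    nlinarith [Real.sin_le_one t]

/-- Wirtinger's inequality transported by `circleDiffeo`. -/
lemma wirtinger_weighted (h0 : 0 ≤ ε) (h1 : ε < 1) {F F' : ℝ → ℝ}
    (hF : ∀ t, HasDerivAt F (F' t) t) (hF' : Continuous F') (hper : F (2 * Real.pi) = F 0)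
    (hmean : ∫ t in (0 : ℝ)..2 * Real.pi, F t * diffeoDeriv ε t = 0) :
    ∫ t in (0 : ℝ)..2 * Real.pi, F t ^ 2 * diffeoDeriv ε t ≤
      ∫ t in (0 : ℝ)..2 * Real.pi, F' t ^ 2 / diffeoDeriv ε t := by
  set e := (strictMono_circleDiffeo h0 h1).orderIsoOfSurjective _ (surjective_circleDiffeo h0)
  set k : ℝ → ℝ := fun t => e.symm t with hk
  have hek : ∀ t, circleDiffeo ε (k t) = t := fun t => e.apply_symm_apply t
  have hke : ∀ t, k (circleDiffeo ε t) = t := fun t => e.symm_apply_apply t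
  have hkc : Continuous k := e.symm.continuous
  have hD := diffeoDeriv_pos h0 h1
  have hDc := (contDiff_diffeoDeriv (ε := ε) (n := 0)).continuous
  have hFc : Continuous F := continuous_iff_continuousAt.2 fun y => (hF y).continuousAt
  have hk' : ∀ t, HasDerivAt k (diffeoDeriv ε (k t))⁻¹ t := fun t =>
    HasDerivAt.of_local_left_inverse hkc.continuousAt (hasDerivAt_circleDiffeo (k t)) (hD _).ne'
      (Filter.Eventually.of_forall hek)
  have hf : ∀ t, HasDerivAt (fun t => F (k t)) (F' (k t) * (diffeoDeriv ε (k t))⁻¹) t :=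
    fun t => (hF (k t)).comp t (hk' t)
  have hf' : Continuous fun t => F' (k t) * (diffeoDeriv ε (k t))⁻¹ :=
    (hF'.comp hkc).mul ((hDc.comp hkc).inv₀ fun t => (hD _).ne')
  have hsub : ∀ G : ℝ → ℝ, Continuous G → ∫ t in (0 : ℝ)..2 * Real.pi, G (k t) =
      ∫ t in (0 : ℝ)..2 * Real.pi, G t * diffeoDeriv ε t := by
    intro G hG
    have h := intervalIntegral.integral_comp_mul_deriv (a := 0) (b := 2 * Real.pi)
      (f := circleDiffeo ε) (f' := diffeoDeriv ε) (g := fun t => G (k t))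
      (fun t _ => hasDerivAt_circleDiffeo t) hDc.continuousOn (hG.comp hkc)
    rw [circleDiffeo_two_pi, circleDiffeo_zero] at h
    rw [← h]
    simp only [Function.comp, hke]
  have hk0 : k 0 = 0 := by simpa [circleDiffeo_zero] using hke 0
  have hk2 : k (2 * Real.pi) = 2 * Real.pi := by
    simpa [circleDiffeo_two_pi] using hke (2 * Real.pi)
  have h := wirtinger_of_integral_eq_zero hf hf' (by rw [hk0, hk2, hper])
    (by rw [hsub F hFc, hmean])
  rw [hsub (fun t => F t ^ 2) (by fun_prop),
    hsub (fun t => (F' t * (diffeoDeriv ε t)⁻¹) ^ 2)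
      ((hF'.mul (hDc.inv₀ fun t => (hD _).ne')).pow 2)] at h
  refine h.trans_eq (intervalIntegral.integral_congr fun t _ => ?_)
  have := (hD t).ne'
  field_simp

/-- The Hill form is nonnegative on a hyperplane. -/
lemma hillForm_nonneg (h0 : 0 ≤ ε) (h1 : ε < 1) {z z' : ℝ → ℝ}
    (hz : ∀ t, HasDerivAt z (z' t) t) (hz' : Continuous z') (hper : z (2 * Real.pi) = z 0)
    (hmean : ∫ t in (0 : ℝ)..2 * Real.pi, √(diffeoDeriv ε t) * z t * diffeoDeriv ε t = 0) :
    ∫ t in (0 : ℝ)..2 * Real.pi, profile ε t * z t ^ 2 ≤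
      ∫ t in (0 : ℝ)..2 * Real.pi, z' t ^ 2 := by
  have hD := diffeoDeriv_pos h0 h1
  have hDc := (contDiff_diffeoDeriv (ε := ε) (n := 0)).continuous
  have hs := (contDiff_logDeriv₁ h0 h1 (n := 0)).continuous
  have hs2 := (contDiff_logDeriv₂ h0 h1 (n := 0)).continuous
  have hp := (contDiff_profile h0 h1 (n := 0)).continuous
  have hzc : Continuous z := continuous_iff_continuousAt.2 fun y => (hz y).continuousAt
  have hF : ∀ t, HasDerivAt (fun t => √(diffeoDeriv ε t) * z t)
      (√(diffeoDeriv ε t) * (z' t + logDeriv₁ ε t / 2 * z t)) t := fun t => by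
    refine HasDerivAt.congr_deriv ((hasDerivAt_sqrt_diffeoDeriv h0 h1 t).mul (hz t)) ?_
    ring
  have hD2 : diffeoDeriv ε (2 * Real.pi) = diffeoDeriv ε 0 := by
    simpa using periodic_diffeoDeriv (ε := ε) 0
  have hs2π : logDeriv₁ ε (2 * Real.pi) = logDeriv₁ ε 0 := by
    simpa using periodic_logDeriv₁ (ε := ε) 0
  have h := wirtinger_weighted h0 h1 hF (by fun_prop) (by simp only [hper, hD2]) hmean
  -- The integrand is the derivative of the periodic function `(s/2) z²`, with `s = logDeriv₁ ε`.
  have hboundary : ∫ t in (0 : ℝ)..2 * Real.pi,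
      (logDeriv₂ ε t / 2 * z t ^ 2 + logDeriv₁ ε t / 2 * (2 * z t * z' t)) = 0 := by
    have hd : ∀ t, HasDerivAt (fun t => logDeriv₁ ε t / 2 * z t ^ 2)
        (logDeriv₂ ε t / 2 * z t ^ 2 + logDeriv₁ ε t / 2 * (2 * z t * z' t)) t := fun t => by
      refine HasDerivAt.congr_deriv
        (((hasDerivAt_logDeriv₁ h0 h1 t).div_const 2).mul ((hz t).pow 2)) ?_
      simp
    rw [intervalIntegral.integral_eq_sub_of_hasDerivAt (fun t _ => hd t)
      (Continuous.intervalIntegrable (by fun_prop) _ _), hs2π, hper, sub_self]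
  have e1 : ∫ t in (0 : ℝ)..2 * Real.pi, (√(diffeoDeriv ε t) * z t) ^ 2 * diffeoDeriv ε t =
      ∫ t in (0 : ℝ)..2 * Real.pi, diffeoDeriv ε t ^ 2 * z t ^ 2 :=
    intervalIntegral.integral_congr fun t _ => by
      simp only [mul_pow, Real.sq_sqrt (hD t).le]; ring
  have e2 : ∫ t in (0 : ℝ)..2 * Real.pi,
      (√(diffeoDeriv ε t) * (z' t + logDeriv₁ ε t / 2 * z t)) ^ 2 / diffeoDeriv ε t =
      ∫ t in (0 : ℝ)..2 * Real.pi, (z' t + logDeriv₁ ε t / 2 * z t) ^ 2 :=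
    intervalIntegral.integral_congr fun t _ => by
      have := (hD t).ne'
      simp only [mul_pow, Real.sq_sqrt (hD t).le]
      field_simp
  rw [e1, e2] at h
  -- Completing the square: `z'² = p z² - (f')² z² + (z' + s z/2)² - ((s/2) z²)'`.
  have e3 : ∫ t in (0 : ℝ)..2 * Real.pi, z' t ^ 2 =
      (∫ t in (0 : ℝ)..2 * Real.pi, profile ε t * z t ^ 2) -
      (∫ t in (0 : ℝ)..2 * Real.pi, diffeoDeriv ε t ^ 2 * z t ^ 2) +
      (∫ t in (0 : ℝ)..2 * Real.pi, (z' t + logDeriv₁ ε t / 2 * z t) ^ 2) -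
      ∫ t in (0 : ℝ)..2 * Real.pi,
        (logDeriv₂ ε t / 2 * z t ^ 2 + logDeriv₁ ε t / 2 * (2 * z t * z' t)) := by
    rw [← intervalIntegral.integral_sub, ← intervalIntegral.integral_add,
      ← intervalIntegral.integral_sub]
    · refine intervalIntegral.integral_congr fun t _ => ?_
      simp only [profile]
      ring
    all_goals exact Continuous.intervalIntegrable (by fun_prop) _ _
  rw [e3, hboundary]
  linarith

/-- The periodic problem `w'' = -ν · profile · w` has no eigenvalue `ν` in `(0, 1)`. -/
theorem hill_eq_zero (h0 : 0 ≤ ε) (h1 : ε ≤ 1 / 10) {ν : ℝ} (hν0 : 0 < ν) (hν1 : ν < 1)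
    {w w' : ℝ → ℝ} (hw : ∀ t, HasDerivAt w (w' t) t)
    (hw' : ∀ t, HasDerivAt w' (-(ν * profile ε t * w t)) t)
    (hper : Function.Periodic w (2 * Real.pi)) (hper' : w' (2 * Real.pi) = w' 0) (t : ℝ) :
    w t = 0 := by
  have hε : ε < 1 := by linarith
  have hpos : 0 < 2 * Real.pi := by positivity
  have hD := diffeoDeriv_pos h0 hε
  have hDc := (contDiff_diffeoDeriv (ε := ε) (n := 0)).continuous
  have hp := (contDiff_profile h0 hε (n := 0)).continuous
  have hwc : Continuous w := continuous_iff_continuousAt.2 fun y => (hw y).continuousAt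
  have hwc' : Continuous w' := continuous_iff_continuousAt.2 fun y => (hw' y).continuousAt
  have hper0 : w (2 * Real.pi) = w 0 := by simpa using hper 0
  have hint : ∀ f : ℝ → ℝ, Continuous f → IntervalIntegrable f volume 0 (2 * Real.pi) :=
    fun f hf => hf.intervalIntegrable _ _
  have horth : ∫ t in (0 : ℝ)..2 * Real.pi, profile ε t * w t = 0 := by
    have h := intervalIntegral.integral_eq_sub_of_hasDerivAt (a := 0) (b := 2 * Real.pi)
      (fun t _ => hw' t) (hint _ (by fun_prop))
    rw [hper', sub_self] at h
    have e : ∀ t, -(ν * profile ε t * w t) = -ν * (profile ε t * w t) := fun t => by ring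
    simp only [e, intervalIntegral.integral_const_mul] at h
    exact (mul_eq_zero.1 h).resolve_left (by linarith)
  have henergy : ∫ t in (0 : ℝ)..2 * Real.pi, w' t ^ 2 =
      ν * ∫ t in (0 : ℝ)..2 * Real.pi, profile ε t * w t ^ 2 := by
    have hd : ∀ t, HasDerivAt (fun t => w t * w' t)
        (w' t ^ 2 - ν * (profile ε t * w t ^ 2)) t := fun t => by
      refine HasDerivAt.congr_deriv ((hw t).mul (hw' t)) ?_
      ring
    have h := intervalIntegral.integral_eq_sub_of_hasDerivAt (a := 0) (b := 2 * Real.pi)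
      (fun t _ => hd t) (hint _ (by fun_prop))
    rw [hper', hper0, sub_self, intervalIntegral.integral_sub (hint _ (by fun_prop))
      (hint _ (by fun_prop)), intervalIntegral.integral_const_mul] at h
    linarith
  set A := ∫ t in (0 : ℝ)..2 * Real.pi, √(diffeoDeriv ε t) * diffeoDeriv ε t with hA
  set B := ∫ t in (0 : ℝ)..2 * Real.pi, √(diffeoDeriv ε t) * w t * diffeoDeriv ε t with hB
  have hApos : 0 < A := intervalIntegral.intervalIntegral_pos_of_pos (hint _ (by fun_prop))
    (fun t => mul_pos (Real.sqrt_pos.2 (hD t)) (hD t)) hpos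
  -- This constant places `w - c` in the hyperplane where the form is nonnegative.
  set c := B / A with hc
  have hform := hillForm_nonneg h0 hε (z := fun t => w t - c) (z' := w')
    (fun t => (hw t).sub_const c) hwc' (by simp only [hper0]) (by
      have e : ∀ t, √(diffeoDeriv ε t) * (w t - c) * diffeoDeriv ε t =
        √(diffeoDeriv ε t) * w t * diffeoDeriv ε t -
          c * (√(diffeoDeriv ε t) * diffeoDeriv ε t) := fun t => by ring
      simp only [e]
      rw [intervalIntegral.integral_sub (hint _ (by fun_prop)) (hint _ (by fun_prop)),
        intervalIntegral.integral_const_mul, ← hA, ← hB, hc, div_mul_cancel₀ _ hApos.ne',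
        sub_self])
  have hexp : ∫ t in (0 : ℝ)..2 * Real.pi, profile ε t * (w t - c) ^ 2 =
      (∫ t in (0 : ℝ)..2 * Real.pi, profile ε t * w t ^ 2) +
        c ^ 2 * ∫ t in (0 : ℝ)..2 * Real.pi, profile ε t := by
    have e : ∀ t, profile ε t * (w t - c) ^ 2 =
        profile ε t * w t ^ 2 - 2 * c * (profile ε t * w t) + c ^ 2 * profile ε t :=
      fun t => by ring
    simp only [e]
    rw [intervalIntegral.integral_add (hint _ (by fun_prop)) (hint _ (by fun_prop)),
      intervalIntegral.integral_sub (hint _ (by fun_prop)) (hint _ (by fun_prop)),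
      intervalIntegral.integral_const_mul, intervalIntegral.integral_const_mul, horth]
    ring
  have hnn : ∀ t, 0 ≤ profile ε t * w t ^ 2 := fun t =>
    mul_nonneg (profile_pos h0 h1 t).le (sq_nonneg _)
  have hI := intervalIntegral.integral_nonneg (a := 0) (b := 2 * Real.pi) (μ := volume) hpos.le
    (fun t _ => hnn t)
  have hJ := intervalIntegral.integral_nonneg (a := 0) (b := 2 * Real.pi) (μ := volume) hpos.le
    (fun t _ => (profile_pos h0 h1 t).le)
  rw [hexp, henergy] at hform
  -- Since `w` is orthogonal to constants for the weight `p`, the form at `w - c` equals `(ν - 1) ∫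
  -- p w² - c² ∫ p`, and it must be nonnegative.
  have hzero : ∫ t in (0 : ℝ)..2 * Real.pi, profile ε t * w t ^ 2 = 0 := by
    nlinarith [mul_nonneg (sq_nonneg c) hJ]
  have := eq_zero_of_integral_eq_zero hpos (by fun_prop) hnn
    (fun t => by simp only [hper t, periodic_profile t]) hzero t
  rcases mul_eq_zero.1 this with h | h
  · exact absurd h (profile_pos h0 h1 t).ne'
  · exact pow_eq_zero_iff (two_ne_zero) |>.1 h

/-! ### The explicit solution at eigenvalue one -/

/-- An explicit solution of `v'' = -profile · v`. -/
def hillSolution (ε t : ℝ) : ℝ := Real.cos (circleDiffeo ε t) / √(diffeoDeriv ε t)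

/-- The derivative of `hillSolution`. -/
def hillSolutionDeriv (ε t : ℝ) : ℝ :=
  -(√(diffeoDeriv ε t) * Real.sin (circleDiffeo ε t)) - logDeriv₁ ε t / 2 * hillSolution ε t

lemma contDiff_hillSolution (h0 : 0 ≤ ε) (h1 : ε < 1) {n : WithTop ℕ∞} :
    ContDiff ℝ n (hillSolution ε) := by
  have hD := diffeoDeriv_pos h0 h1
  refine ContDiff.div (Real.contDiff_cos.comp contDiff_circleDiffeo)
    (contDiff_diffeoDeriv.sqrt fun t => (hD t).ne') fun t => (Real.sqrt_pos.2 (hD t)).ne'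

lemma periodic_hillSolution : Function.Periodic (hillSolution ε) (2 * Real.pi) := fun t => by
  simp [hillSolution, circleDiffeo_add_two_pi, periodic_diffeoDeriv t]

lemma hasDerivAt_hillSolution (h0 : 0 ≤ ε) (h1 : ε < 1) (t : ℝ) :
    HasDerivAt (hillSolution ε) (hillSolutionDeriv ε t) t := by
  have hD := diffeoDeriv_pos h0 h1 t
  have hs := Real.sqrt_pos.2 hD
  refine HasDerivAt.congr_deriv
    (((hasDerivAt_circleDiffeo t).cos).div (hasDerivAt_sqrt_diffeoDeriv h0 h1 t) hs.ne') ?_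
  rw [hillSolutionDeriv, hillSolution]
  have h2 := Real.sq_sqrt hD.le
  set r := √(diffeoDeriv ε t)
  rw [← h2]
  field_simp

lemma hasDerivAt_hillSolutionDeriv (h0 : 0 ≤ ε) (h1 : ε < 1) (t : ℝ) :
    HasDerivAt (hillSolutionDeriv ε) (-(profile ε t * hillSolution ε t)) t := by
  have hD := diffeoDeriv_pos h0 h1 t
  have hs := Real.sqrt_pos.2 hD
  refine HasDerivAt.congr_deriv ((((hasDerivAt_sqrt_diffeoDeriv h0 h1 t).mul
    ((hasDerivAt_circleDiffeo t).sin)).fun_neg.sub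
    (((hasDerivAt_logDeriv₁ h0 h1 t).div_const 2).mul (hasDerivAt_hillSolution h0 h1 t)))) ?_
  rw [hillSolutionDeriv, hillSolution, profile]
  have h2 := Real.sq_sqrt hD.le
  set r := √(diffeoDeriv ε t)
  rw [← h2]
  field_simp
  ring

end Profile


/-! ### Fourier modes on the torus -/

/-- Above the gap, the quasi-periodic problem `W'' = (q - ν · profile) W` has no solution. -/
lemma quasiPeriodic_hill_eq_zero {ε ν : ℝ} (h0 : 0 ≤ ε) (h1 : ε ≤ 1 / 10) (hν0 : 0 < ν)
    (hν1 : ν < 1) (q α : ℝ) (hgap : ∀ n : ℤ, 1 + 4 * ε ≤ q + (n - α) ^ 2) {W W' : ℝ → ℂ}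
    (hW : ∀ t, HasDerivAt W (W' t) t)
    (hW' : ∀ t, HasDerivAt W' (((q - ν * profile ε t : ℝ) : ℂ) * W t) t)
    (hper : ∀ t, W (t + 2 * Real.pi) =
      Complex.exp (((-(2 * Real.pi * α) : ℝ) : ℂ) * Complex.I) * W t)
    (hper' : ∀ t, W' (t + 2 * Real.pi) =
      Complex.exp (((-(2 * Real.pi * α) : ℝ) : ℂ) * Complex.I) * W' t) (t : ℝ) :
    W t = 0 := by
  have hε : ε < 1 := by linarith
  have hpos : 0 < 2 * Real.pi := by positivity
  have hp := (contDiff_profile h0 hε (n := 0)).continuous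
  have hWc : Continuous W := continuous_iff_continuousAt.2 fun y => (hW y).continuousAt
  have hWc' : Continuous W' := continuous_iff_continuousAt.2 fun y => (hW' y).continuousAt
  have hint : ∀ f : ℝ → ℝ, Continuous f → IntervalIntegrable f volume 0 (2 * Real.pi) :=
    fun f hf => hf.intervalIntegrable _ _
  -- The admissible frequencies are `n - α`, so the gap gives `(1 + 4ε - q) ∫ |W|² ≤ ∫ |W'|²`.
  have hwirt := wirtinger_quasiPeriodic hpos (-(2 * Real.pi * α))
    ((2 * Real.pi) ^ 2 * (1 + 4 * ε - q)) hW hWc' (by simpa using hper 0) (fun n => Or.inl (by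
      have e : (2 * Real.pi * n + -(2 * Real.pi * α)) ^ 2 =
          (2 * Real.pi) ^ 2 * (n - α) ^ 2 := by ring
      rw [e]
      exact mul_le_mul_of_nonneg_left (by linarith [hgap n]) (by positivity)))
  rw [mul_assoc] at hwirt
  have hwirt := le_of_mul_le_mul_left hwirt (by positivity)
  have hd : ∀ t, HasDerivAt (fun t => star (W t) * W' t)
      ((‖W' t‖ ^ 2 + (q * ‖W t‖ ^ 2 - ν * (profile ε t * ‖W t‖ ^ 2)) : ℝ) : ℂ) t := fun t => by
    refine HasDerivAt.congr_deriv ((hW t).star.mul (hW' t)) ?_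
    have e1 := Complex.conj_mul' (W' t)
    have e2 := Complex.conj_mul' (W t)
    simp only [Complex.star_def]
    push_cast
    linear_combination e1 + ((q : ℂ) - ν * profile ε t) * e2
  -- The unimodular phases of `W` and `W'` cancel in the conjugate product, so the energy identity
  -- has no boundary term.
  have hbd : star (W (2 * Real.pi)) * W' (2 * Real.pi) = star (W 0) * W' 0 := by
    have e1 := hper 0
    have e2 := hper' 0
    rw [zero_add] at e1 e2
    set E := Complex.exp (((-(2 * Real.pi * α) : ℝ) : ℂ) * Complex.I) with hE
    have hEE : (starRingEnd ℂ) E * E = 1 := by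
      rw [Complex.conj_mul', hE, Complex.norm_exp_ofReal_mul_I]; norm_num
    rw [e1, e2]
    simp only [Complex.star_def, map_mul]
    linear_combination (starRingEnd ℂ) (W 0) * W' 0 * hEE
  have hen := intervalIntegral.integral_eq_sub_of_hasDerivAt (a := 0) (b := 2 * Real.pi)
    (fun t _ => hd t) (Continuous.intervalIntegrable (by fun_prop) _ _)
  rw [hbd, sub_self, intervalIntegral.integral_ofReal, Complex.ofReal_eq_zero,
    intervalIntegral.integral_add (hint _ (by fun_prop)) (hint _ (by fun_prop)),
    intervalIntegral.integral_sub (hint _ (by fun_prop)) (hint _ (by fun_prop)),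
    intervalIntegral.integral_const_mul, intervalIntegral.integral_const_mul] at hen
  have hle : ∫ t in (0 : ℝ)..2 * Real.pi, profile ε t * ‖W t‖ ^ 2 ≤
      ∫ t in (0 : ℝ)..2 * Real.pi, (1 + 4 * ε) * ‖W t‖ ^ 2 :=
    intervalIntegral.integral_mono_on hpos.le (hint _ (by fun_prop)) (hint _ (by fun_prop))
      fun t _ => mul_le_mul_of_nonneg_right (profile_le h0 h1 t) (by positivity)
  rw [intervalIntegral.integral_const_mul] at hle
  have hI := intervalIntegral.integral_nonneg (a := 0) (b := 2 * Real.pi) (μ := volume) hpos.le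
    (fun t _ => sq_nonneg ‖W t‖)
  -- The energy identity, Wirtinger's inequality and `p ≤ 1 + 4ε` combine to `(1 - ν)(1 + 4ε) ∫ |W|²
  -- ≤ 0`.
  have hzero : ∫ t in (0 : ℝ)..2 * Real.pi, ‖W t‖ ^ 2 = 0 := by
    set I := ∫ t in (0 : ℝ)..2 * Real.pi, ‖W t‖ ^ 2
    have h3 := mul_le_mul_of_nonneg_left hle hν0.le
    have h4 : (1 - ν) * (1 + 4 * ε) * I ≤ 0 := by linarith
    have h5 : 0 < (1 - ν) * (1 + 4 * ε) := mul_pos (by linarith) (by linarith)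
    nlinarith
  have := eq_zero_of_integral_eq_zero hpos (by fun_prop) (fun t => sq_nonneg ‖W t‖)
    (fun t => by simp only [hper t, norm_mul, Complex.norm_exp_ofReal_mul_I, one_mul]) hzero t
  simpa using this

/-- The potential is real, so real and imaginary parts solve the problem separately. -/
lemma hill_eq_zero_complex {ε ν : ℝ} (h0 : 0 ≤ ε) (h1 : ε ≤ 1 / 10) (hν0 : 0 < ν)
    (hν1 : ν < 1) {W W' : ℝ → ℂ} (hW : ∀ t, HasDerivAt W (W' t) t)
    (hW' : ∀ t, HasDerivAt W' (((-(ν * profile ε t) : ℝ) : ℂ) * W t) t)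
    (hper : ∀ t, W (t + 2 * Real.pi) = W t) (hper' : ∀ t, W' (t + 2 * Real.pi) = W' t) (t : ℝ) :
    W t = 0 := by
  have hper0 := hper' 0
  rw [zero_add] at hper0
  apply Complex.ext
  · refine hill_eq_zero h0 h1 hν0 hν1 (w := fun t => (W t).re) (w' := fun t => (W' t).re)
      (fun t => Complex.reCLM.hasFDerivAt.comp_hasDerivAt t (hW t)) (fun t => ?_)
      (fun t => by simp only [hper]) (by simp only [hper0]) t
    refine HasDerivAt.congr_deriv (Complex.reCLM.hasFDerivAt.comp_hasDerivAt t (hW' t)) ?_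
    rw [Complex.reCLM_apply, Complex.re_ofReal_mul, neg_mul]
  · refine hill_eq_zero h0 h1 hν0 hν1 (w := fun t => (W t).im) (w' := fun t => (W' t).im)
      (fun t => Complex.imCLM.hasFDerivAt.comp_hasDerivAt t (hW t)) (fun t => ?_)
      (fun t => by simp only [hper]) (by simp only [hper0]) t
    refine HasDerivAt.congr_deriv (Complex.imCLM.hasFDerivAt.comp_hasDerivAt t (hW' t)) ?_
    rw [Complex.imCLM_apply, Complex.im_ofReal_mul, neg_mul]

/-- The `m`-th Fourier coefficient in `x` of a function on `ℝ × ℝ`. -/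
def xCoeff (m : ℤ) (U : ℝ → ℝ → ℝ) (t : ℝ) : ℂ :=
  ∫ x in (0 : ℝ)..1,
    Complex.exp (((-((2 * Real.pi * m + 0) / 1 * x) : ℝ) : ℂ) * Complex.I) * (U x t : ℂ)

lemma hasDerivAt_xCoeff (m : ℤ) {U Ut : ℝ → ℝ → ℝ} (hU : Continuous (Function.uncurry U))
    (hUt : Continuous (Function.uncurry Ut))
    (hd : ∀ x t, HasDerivAt (fun t => U x t) (Ut x t) t) (t : ℝ) :
    HasDerivAt (xCoeff m U) (xCoeff m Ut t) t := by
  refine hasDerivAt_integral_of_continuous (F := fun t x =>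
    Complex.exp (((-((2 * Real.pi * m + 0) / 1 * x) : ℝ) : ℂ) * Complex.I) * (U x t : ℂ))
    (F' := fun t x =>
    Complex.exp (((-((2 * Real.pi * m + 0) / 1 * x) : ℝ) : ℂ) * Complex.I) * (Ut x t : ℂ))
    0 1 (fun t => ?_) ?_ (fun t x => ?_) t
  · have : Continuous fun x => U x t := hU.comp (by fun_prop : Continuous fun x : ℝ => (x, t))
    fun_prop
  · have : Continuous fun p : ℝ × ℝ => Ut p.2 p.1 :=
      hUt.comp (by fun_prop : Continuous fun p : ℝ × ℝ => (p.2, p.1))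
    unfold Function.uncurry
    fun_prop
  · exact (hd x t).ofReal_comp.const_mul _

/-- The slanted lattice generator shifts `x` by `α` as `t` completes a period; shifting a
`1`-periodic integrand leaves only the phase `e^{-2πimα}`. -/
lemma xCoeff_add (m : ℤ) {U : ℝ → ℝ → ℝ} {α : ℝ} (hx : ∀ x t, U (x + 1) t = U x t)
    (ht : ∀ x t, U (x + α) (t + 2 * Real.pi) = U x t) (t : ℝ) :
    xCoeff m U (t + 2 * Real.pi) =
      Complex.exp (((-(2 * Real.pi * (m * α)) : ℝ) : ℂ) * Complex.I) * xCoeff m U t := by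
  set G : ℝ → ℂ := fun x =>
    Complex.exp (((-((2 * Real.pi * m + 0) / 1 * x) : ℝ) : ℂ) * Complex.I) *
      (U x (t + 2 * Real.pi) : ℂ) with hG
  have hGper : Function.Periodic G 1 := fun x => by
    simp only [hG, hx]
    congr 1
    rw [Complex.exp_eq_exp_iff_exists_int]
    refine ⟨-m, ?_⟩
    push_cast
    ring
  have h := hGper.intervalIntegral_add_eq α 0
  rw [xCoeff, xCoeff]
  change ∫ x in (0 : ℝ)..1, G x = _
  rw [zero_add] at h
  rw [← h, add_comm α 1, ← intervalIntegral.integral_const_mul]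
  have h2 := intervalIntegral.integral_comp_add_right (a := 0) (b := 1) G α
  rw [zero_add] at h2
  rw [← h2]
  refine intervalIntegral.integral_congr fun x _ => ?_
  simp only [hG, ht]
  rw [← mul_assoc, ← Complex.exp_add]
  congr 2
  push_cast
  ring

/-- A function on the torus, in coordinates, solving `c/(4π²) U_xx + U_tt = -ν · profile · U` with
`ν ∈ (0, 1)` vanishes, provided the modes depending on `x` lie above the gap. -/
theorem eq_zero_of_pde {ε ν c α : ℝ} (h0 : 0 ≤ ε) (h1 : ε ≤ 1 / 10) (hν0 : 0 < ν)
    (hν1 : ν < 1) (hgap : ∀ m n : ℤ, m ≠ 0 → 1 + 4 * ε ≤ m ^ 2 * c + (n - m * α) ^ 2)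
    {U Ux Uxx Ut Utt : ℝ → ℝ → ℝ} (hU : Continuous (Function.uncurry U))
    (hUt : Continuous (Function.uncurry Ut)) (hUtt : Continuous (Function.uncurry Utt))
    (hUxx : Continuous (Function.uncurry Uxx))
    (hdx : ∀ x t, HasDerivAt (fun x => U x t) (Ux x t) x)
    (hdxx : ∀ x t, HasDerivAt (fun x => Ux x t) (Uxx x t) x)
    (hdt : ∀ x t, HasDerivAt (fun t => U x t) (Ut x t) t)
    (hdtt : ∀ x t, HasDerivAt (fun t => Ut x t) (Utt x t) t)
    (hx : ∀ x t, U (x + 1) t = U x t) (ht : ∀ x t, U (x + α) (t + 2 * Real.pi) = U x t)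
    (hpde : ∀ x t, c / (2 * Real.pi) ^ 2 * Uxx x t + Utt x t = -(ν * profile ε t * U x t))
    (x t : ℝ) : U x t = 0 := by
  have hsec : ∀ {V : ℝ → ℝ → ℝ}, Continuous (Function.uncurry V) → ∀ t,
      Continuous fun x => V x t := fun hV t =>
    hV.comp (by fun_prop : Continuous fun x : ℝ => (x, t))
  have hxUx : ∀ x t, Ux (x + 1) t = Ux x t := fun x t => by
    have h := (hdx (x + 1) t).comp_add_const x 1
    simp only [hx] at h
    exact h.unique (hdx x t)
  have hxUt : ∀ x t, Ut (x + 1) t = Ut x t := fun x t => by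
    have h := hdt (x + 1) t
    simp only [hx] at h
    exact h.unique (hdt x t)
  have htUt : ∀ x t, Ut (x + α) (t + 2 * Real.pi) = Ut x t := fun x t => by
    have h := (hdt (x + α) (t + 2 * Real.pi)).comp_add_const t (2 * Real.pi)
    simp only [ht] at h
    exact h.unique (hdt x t)
  have hode : ∀ (m : ℤ) (t : ℝ), xCoeff m Utt t =
      ((m ^ 2 * c - ν * profile ε t : ℝ) : ℂ) * xCoeff m U t := by
    intro m t
    have hUxc : Continuous fun x => Ux x t :=
      continuous_iff_continuousAt.2 fun y => (hdxx y t).continuousAt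
    have e1 := integral_twisted_deriv one_pos 0 (fun y => (hdx y t).ofReal_comp)
      (Complex.continuous_ofReal.comp hUxc) (by simpa using hx 0 t) m
    have e2 := integral_twisted_deriv one_pos 0 (fun y => (hdxx y t).ofReal_comp)
      (Complex.continuous_ofReal.comp (hsec hUxx t)) (by simpa using hxUx 0 t) m
    have e3 : xCoeff m Utt t = -((c / (2 * Real.pi) ^ 2 : ℝ) : ℂ) * xCoeff m Uxx t -
        ((ν * profile ε t : ℝ) : ℂ) * xCoeff m U t := by
      have c1 := hsec hUxx t
      have c2 := hsec hU t
      simp only [xCoeff]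
      rw [← intervalIntegral.integral_const_mul, ← intervalIntegral.integral_const_mul,
        ← intervalIntegral.integral_sub (Continuous.intervalIntegrable (by fun_prop) _ _)
          (Continuous.intervalIntegrable (by fun_prop) _ _)]
      refine intervalIntegral.integral_congr fun x _ => ?_
      have : Utt x t = -(ν * profile ε t * U x t) - c / (2 * Real.pi) ^ 2 * Uxx x t := by
        linarith [hpde x t]
      simp only [this]
      push_cast
      ring
    have e4 : xCoeff m Uxx t = -((2 * Real.pi * m : ℝ) : ℂ) ^ 2 * xCoeff m U t := by
      rw [xCoeff, e2, e1, xCoeff]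
      push_cast
      linear_combination ((2 * Real.pi * m : ℂ)) ^ 2 * (∫ y in (0 : ℝ)..1,
        Complex.exp ((-((2 * (Real.pi : ℂ) * m + 0) / 1 * y)) * Complex.I) * (U y t : ℂ)) *
          Complex.I_sq
    rw [e3, e4]
    have : (Real.pi : ℂ) ≠ 0 := Complex.ofReal_ne_zero.2 Real.pi_ne_zero
    push_cast
    field_simp
  have hW : ∀ m t, HasDerivAt (xCoeff m U) (xCoeff m Ut t) t := fun m t =>
    hasDerivAt_xCoeff m hU hUt hdt t
  have hW' : ∀ (m : ℤ) t, HasDerivAt (xCoeff m Ut)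
      (((m ^ 2 * c - ν * profile ε t : ℝ) : ℂ) * xCoeff m U t) t := fun m t =>
    (hasDerivAt_xCoeff m hUt hUtt hdtt t).congr_deriv (hode m t)
  have hzero : ∀ m, xCoeff m U t = 0 := by
    intro m
    have p1 := xCoeff_add m hx ht
    have p2 := xCoeff_add m hxUt htUt
    rcases eq_or_ne m 0 with rfl | hm
    · refine hill_eq_zero_complex h0 h1 hν0 hν1 (hW 0) (fun t => ?_)
        (fun t => by simpa using p1 t) (fun t => by simpa using p2 t) t
      refine (hW' 0 t).congr_deriv ?_
      simp
    · exact quasiPeriodic_hill_eq_zero h0 h1 hν0 hν1 _ (m * α) (fun n => hgap m n hm)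
        (hW m) (hW' m) p1 p2 t
  have hI := integral_sq_norm_eq_zero_of_fourier one_pos
    (Complex.continuous_ofReal.comp (hsec hU t)) (fun m => by simpa [xCoeff] using hzero m)
  have := eq_zero_of_integral_eq_zero one_pos (by
    have := hsec hU t
    fun_prop) (fun x => sq_nonneg ‖((U x t : ℝ) : ℂ)‖)
    (fun x => by simp only [hx x t]) hI x
  simpa using this

variable {a b : ℝ}

/-! ### Derivatives in plane coordinates -/

section Coordinates

lemma vec_eq (x y : ℝ) : (!₂[x, y] : Plane) =
    x • EuclideanSpace.single 0 1 + y • EuclideanSpace.single 1 1 := by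
  ext i
  fin_cases i <;> simp

lemma vec_eta (p : Plane) : (!₂[p 0, p 1] : Plane) = p := by
  ext i
  fin_cases i <;> simp

lemma hasDerivAt_vec_left (x y : ℝ) :
    HasDerivAt (fun x : ℝ => (!₂[x, y] : Plane)) (EuclideanSpace.single 0 1) x := by
  simp only [vec_eq]
  simpa using ((hasDerivAt_id' x).smul_const (EuclideanSpace.single (0 : Fin 2) (1 : ℝ))).add_const
    (y • EuclideanSpace.single (1 : Fin 2) (1 : ℝ))

lemma hasDerivAt_vec_right (k x y : ℝ) :
    HasDerivAt (fun y : ℝ => (!₂[x, k * y] : Plane)) (k • EuclideanSpace.single 1 1) y := by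
  simp only [vec_eq]
  simpa using (((hasDerivAt_id' y).const_mul k).smul_const
    (EuclideanSpace.single (1 : Fin 2) (1 : ℝ))).const_add
    (x • EuclideanSpace.single (0 : Fin 2) (1 : ℝ))

lemma continuous_vec (k : ℝ) : Continuous fun p : ℝ × ℝ => (!₂[p.1, k * p.2] : Plane) := by
  simp only [vec_eq]
  fun_prop

lemma contDiff_partialDeriv {f : Plane → ℝ} (hf : ContDiff ℝ ∞ f) (i : Fin 2) :
    ContDiff ℝ ∞ (partialDeriv i f) :=
  (hf.fderiv_right (m := ∞) (by simp)).clm_apply contDiff_const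

lemma hasDerivAt_comp_vec_left {f : Plane → ℝ} (hf : ContDiff ℝ ∞ f) (x y : ℝ) :
    HasDerivAt (fun x : ℝ => f !₂[x, y]) (partialDeriv 0 f !₂[x, y]) x :=
  ((hf.differentiable (by simp)) _).hasFDerivAt.comp_hasDerivAt x (hasDerivAt_vec_left x y)

lemma hasDerivAt_comp_vec_right {f : Plane → ℝ} (hf : ContDiff ℝ ∞ f) (k x y : ℝ) :
    HasDerivAt (fun y : ℝ => f !₂[x, k * y]) (k * partialDeriv 1 f !₂[x, k * y]) y := by
  refine (((hf.differentiable (by simp)) _).hasFDerivAt.comp_hasDerivAt y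
    (hasDerivAt_vec_right k x y)).congr_deriv ?_
  rw [map_smul, smul_eq_mul, partialDeriv]

lemma partialDeriv_zero_fun (i : Fin 2) (p : Plane) : partialDeriv i (fun _ => 0) p = 0 := by
  simp [partialDeriv]

lemma hasFDerivAt_comp_snd {φ : ℝ → ℝ} {d k : ℝ} {p : Plane} (h : HasDerivAt φ d (k * p 1)) :
    HasFDerivAt (fun q : Plane => φ (k * q 1))
      (d • k • (EuclideanSpace.proj 1 : Plane →L[ℝ] ℝ)) p :=
  h.comp_hasFDerivAt p ((EuclideanSpace.proj (𝕜 := ℝ) (1 : Fin 2)).hasFDerivAt.const_mul k)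

lemma partialDeriv_zero_comp_snd {φ φ' : ℝ → ℝ} (h : ∀ t, HasDerivAt φ (φ' t) t) (k : ℝ) :
    partialDeriv 0 (fun q : Plane => φ (k * q 1)) = fun _ => 0 := by
  funext p
  rw [partialDeriv, (hasFDerivAt_comp_snd (h _)).fderiv]
  simp

lemma partialDeriv_one_comp_snd {φ φ' : ℝ → ℝ} (h : ∀ t, HasDerivAt φ (φ' t) t) (k : ℝ) :
    partialDeriv 1 (fun q : Plane => φ (k * q 1)) = fun q => k * φ' (k * q 1) := by
  funext p
  rw [partialDeriv, (hasFDerivAt_comp_snd (h _)).fderiv]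
  simp [mul_comm]

end Coordinates

/-! ### Lattice-periodic functions on the torus -/

section Descend

/-- The function on the torus induced by a lattice-periodic function on the plane. -/
def descend (f : Plane → ℝ) : Torus a b → ℝ := fun x => f x.out

lemma lift_descend {f : Plane → ℝ} (hf : ∀ p, ∀ v ∈ lattice a b, f (p + v) = f p) :
    lift (descend f : Torus a b → ℝ) = f := by
  funext p
  obtain ⟨v, hv⟩ := QuotientAddGroup.mk_out_eq_add (lattice a b) p
  rw [lift, descend, hv, hf p v v.2]

lemma lift_add (u : Torus a b → ℝ) (p : Plane) {v : Plane} (hv : v ∈ lattice a b) :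
    lift u (p + v) = lift u p := by
  unfold lift
  rw [QuotientAddGroup.mk_add_of_mem p hv]

lemma snd_of_mem_lattice {v : Plane} (hv : v ∈ lattice a b) : ∃ n : ℤ, v 1 = n * b := by
  induction hv using AddSubgroup.closure_induction with
  | mem x hx =>
    rcases hx with rfl | rfl
    · exact ⟨0, by simp⟩
    · exact ⟨1, by simp⟩
  | zero => exact ⟨0, by simp⟩
  | add x y _ _ hx hy =>
    obtain ⟨m, hm⟩ := hx
    obtain ⟨n, hn⟩ := hy
    exact ⟨m + n, by simp [hm, hn]; ring⟩
  | neg x _ hx =>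
    obtain ⟨m, hm⟩ := hx
    exact ⟨-m, by simp [hm]⟩

lemma lift_descend_snd (hb : b ≠ 0) {φ : ℝ → ℝ} (hφ : Function.Periodic φ (2 * Real.pi)) :
    lift (descend (fun p => φ (2 * Real.pi / b * p 1)) : Torus a b → ℝ) =
      fun p => φ (2 * Real.pi / b * p 1) := by
  refine lift_descend fun p v hv => ?_
  obtain ⟨n, hn⟩ := snd_of_mem_lattice hv
  have e : 2 * Real.pi / b * (p + v) 1 = 2 * Real.pi / b * p 1 + n * (2 * Real.pi) := by
    rw [PiLp.add_apply, hn]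
    field_simp
  simp only [e]
  exact hφ.int_mul n _

lemma contDiff_comp_snd {φ : ℝ → ℝ} (hφ : ContDiff ℝ ∞ φ) (k : ℝ) :
    ContDiff ℝ ∞ (fun p : Plane => φ (k * p 1)) :=
  hφ.comp (contDiff_const.mul (EuclideanSpace.proj (𝕜 := ℝ) (1 : Fin 2)).contDiff)

end Descend

/-! ### Eigenvalues of metrics conformal to the flat one -/

section Conformal

variable {g : Metric a b} {r : Torus a b → ℝ}

lemma density_of_coeff_eq_smul (hg : ∀ x, g.coeff x = r x • (1 : Matrix (Fin 2) (Fin 2) ℝ))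
    (hr : ∀ x, 0 < r x) : density g = lift r := by
  funext p
  simp only [density, lift, hg]
  rw [Matrix.det_smul, Matrix.det_one, mul_one, Fintype.card_fin, Real.sqrt_sq (hr _).le]

/-- In dimension two `√(det g) g⁻¹` is conformally invariant, hence the identity here; the factor
`r` survives only in the outer density. -/
lemma laplacian_of_coeff_eq_smul (hg : ∀ x, g.coeff x = r x • (1 : Matrix (Fin 2) (Fin 2) ℝ))
    (hr : ∀ x, 0 < r x) (u : Torus a b → ℝ) (p : Plane) :
    laplacian g u p = -(1 / lift r p) *
      (partialDeriv 0 (partialDeriv 0 (lift u)) p + partialDeriv 1 (partialDeriv 1 (lift u)) p) := by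
  have hinv : ∀ x, (g.coeff x)⁻¹ = (r x)⁻¹ • (1 : Matrix (Fin 2) (Fin 2) ℝ) := fun x => by
    refine Matrix.inv_eq_right_inv ?_
    rw [hg, smul_mul_smul_comm, mul_inv_cancel₀ (hr x).ne', one_smul, one_mul]
  have hcoef : ∀ i j : Fin 2, (fun q => density g q * lift (fun x => (g.coeff x)⁻¹ i j) q *
      partialDeriv j (lift u) q) = if i = j then partialDeriv j (lift u) else fun _ => 0 := by
    intro i j
    funext q
    rw [density_of_coeff_eq_smul hg hr]
    simp only [lift, hinv, Matrix.smul_apply, Matrix.one_apply, smul_eq_mul]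
    split_ifs with h
    · rw [mul_one, mul_inv_cancel₀ (hr _).ne', one_mul]
    · simp
  unfold laplacian
  simp only [hcoef, Fin.sum_univ_two]
  simp [partialDeriv_zero_fun, density_of_coeff_eq_smul hg hr]

/-- The case `ε = 0` is allowed, so the flat metric is covered as well. -/
lemma isEigenvalue_of_profile {ε : ℝ} (h0 : 0 ≤ ε) (h1 : ε ≤ 1 / 10) (hb : b ≠ 0)
    (hg : ∀ x, g.coeff x = r x • (1 : Matrix (Fin 2) (Fin 2) ℝ)) (hr : ∀ x, 0 < r x)
    (hlift : ∀ p, lift r p = profile ε (2 * Real.pi / b * p 1)) :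
    IsEigenvalue g ((2 * Real.pi / b) ^ 2) := by
  have hε : ε < 1 := by linarith
  have hu := lift_descend_snd (a := a) hb (periodic_hillSolution (ε := ε))
  refine ⟨descend fun p => hillSolution ε (2 * Real.pi / b * p 1), ?_, ?_, fun p => ?_⟩
  · rw [IsSmooth, hu]
    exact contDiff_comp_snd (contDiff_hillSolution h0 hε) _
  · intro h
    have h2 := congrFun hu 0
    rw [h] at h2
    have h3 : hillSolution ε 0 = 0 := by simpa [lift] using h2.symm
    rw [hillSolution, circleDiffeo_zero, Real.cos_zero] at h3
    exact (one_div_pos.2 (Real.sqrt_pos.2 (diffeoDeriv_pos h0 hε 0))).ne' h3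
  · have hp := (profile_pos h0 h1 (2 * Real.pi / b * p 1)).ne'
    have hd : ∀ t, HasDerivAt (fun t => 2 * Real.pi / b * hillSolutionDeriv ε t)
        (2 * Real.pi / b * -(profile ε t * hillSolution ε t)) t := fun t =>
      (hasDerivAt_hillSolutionDeriv h0 hε t).const_mul _
    rw [laplacian_of_coeff_eq_smul hg hr, hu, hlift,
      partialDeriv_zero_comp_snd (hasDerivAt_hillSolution h0 hε),
      partialDeriv_one_comp_snd (hasDerivAt_hillSolution h0 hε), partialDeriv_zero_fun,
      partialDeriv_one_comp_snd hd]
    beta_reduce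
    generalize profile ε (2 * Real.pi / b * p 1) = P at *
    generalize hillSolution ε (2 * Real.pi / b * p 1) = Q
    field_simp
    ring

lemma eigenvalue_ge_of_profile {ε : ℝ} (h0 : 0 ≤ ε) (h1 : ε ≤ 1 / 10) (hb : b ≠ 0)
    (hgap : ∀ m n : ℤ, m ≠ 0 → 1 + 4 * ε ≤ m ^ 2 * b ^ 2 + (n - m * a) ^ 2)
    (hg : ∀ x, g.coeff x = r x • (1 : Matrix (Fin 2) (Fin 2) ℝ)) (hr : ∀ x, 0 < r x)
    (hlift : ∀ p, lift r p = profile ε (2 * Real.pi / b * p 1)) {μ : ℝ} (hμ : 0 < μ)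
    (h : IsEigenvalue g μ) : (2 * Real.pi / b) ^ 2 ≤ μ := by
  by_contra! hlt
  obtain ⟨u, hu, hne, heq⟩ := h
  have hπ := Real.pi_pos.ne'
  -- Writing `y = k t` gives the second generator height `2π` in `t` and turns `μ < (2π/b)²` into
  -- `k² μ < 1`.
  set k : ℝ := b / (2 * Real.pi) with hk
  have hk0 : k ≠ 0 := div_ne_zero hb (by positivity)
  have hkinv : 2 * Real.pi / b = k⁻¹ := by rw [hk, inv_div]
  have hk2 : 0 < k ^ 2 := by positivity
  rw [hkinv, inv_pow, lt_inv_comm₀ hμ hk2, ← one_div, lt_div_iff₀ hμ] at hlt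
  have d0 := contDiff_partialDeriv hu 0
  have d1 := contDiff_partialDeriv hu 1
  have d00 := contDiff_partialDeriv d0 0
  have d11 := contDiff_partialDeriv d1 1
  have hcont : ∀ f : Plane → ℝ, ContDiff ℝ ∞ f → ∀ c : ℝ,
      Continuous (Function.uncurry fun x t : ℝ => c * f !₂[x, k * t]) := fun f hf c =>
    continuous_const.mul (hf.continuous.comp (continuous_vec k))
  have hzero := eq_zero_of_pde h0 h1 (ν := k ^ 2 * μ) (by positivity) hlt hgap
    (U := fun x t => lift u !₂[x, k * t]) (Ux := fun x t => partialDeriv 0 (lift u) !₂[x, k * t])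
    (Uxx := fun x t => partialDeriv 0 (partialDeriv 0 (lift u)) !₂[x, k * t])
    (Ut := fun x t => k * partialDeriv 1 (lift u) !₂[x, k * t])
    (Utt := fun x t => k * (k * partialDeriv 1 (partialDeriv 1 (lift u)) !₂[x, k * t]))
    (by simpa using hcont _ hu 1) (hcont _ d1 k) (by simpa [mul_assoc] using hcont _ d11 (k * k))
    (by simpa using hcont _ d00 1)
    (fun x t => hasDerivAt_comp_vec_left hu x _) (fun x t => hasDerivAt_comp_vec_left d0 x _)
    (fun x t => hasDerivAt_comp_vec_right hu k x t)
    (fun x t => (hasDerivAt_comp_vec_right d1 k x t).const_mul k)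
    (fun x t => by
      have hv : (!₂[(1 : ℝ), 0] : Plane) ∈ lattice a b :=
        AddSubgroup.subset_closure (Set.mem_insert _ _)
      have := lift_add u !₂[x, k * t] hv
      rw [← this]
      congr 1
      ext i
      fin_cases i <;> simp)
    (fun x t => by
      have hv : (!₂[a, b] : Plane) ∈ lattice a b :=
        AddSubgroup.subset_closure (Set.mem_insert_of_mem _ rfl)
      have := lift_add u !₂[x, k * t] hv
      rw [← this]
      congr 1
      have : k * (2 * Real.pi) = b := by rw [hk]; field_simp
      ext i
      fin_cases i <;> simp [mul_add, this])
    (fun x t => by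
      have h := heq !₂[x, k * t]
      have hpp := (profile_pos h0 h1 t).ne'
      rw [laplacian_of_coeff_eq_smul hg hr, hlift, hkinv] at h
      have e : k⁻¹ * (!₂[x, k * t] : Plane) 1 = t := by simp [hk0]
      rw [e] at h
      have e2 : b ^ 2 / (2 * Real.pi) ^ 2 = k ^ 2 := by rw [hk, div_pow]
      rw [e2]
      field_simp at h
      linear_combination (-k ^ 2) * h)
  refine hne (funext fun q => ?_)
  obtain ⟨p, rfl⟩ := QuotientAddGroup.mk_surjective q
  have h2 := hzero (p 0) (k⁻¹ * p 1)
  rw [mul_inv_cancel_left₀ hk0, vec_eta] at h2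
  exact h2

end Conformal

/-! ### Area of the fundamental parallelogram -/

section Area

/-- The linear map sending the standard basis to the basis `(1, 0), (a, b)` of the lattice. -/
def latticeMap (a b : ℝ) : Plane →L[ℝ] Plane :=
  (EuclideanSpace.proj 0 : Plane →L[ℝ] ℝ).smulRight !₂[(1 : ℝ), 0] +
    (EuclideanSpace.proj 1 : Plane →L[ℝ] ℝ).smulRight !₂[a, b]

lemma latticeMap_apply (p : Plane) :
    latticeMap a b p = p 0 • !₂[(1 : ℝ), 0] + p 1 • !₂[a, b] := by
  simp [latticeMap]

lemma det_latticeMap : (latticeMap a b).det = b := by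
  rw [ContinuousLinearMap.det,
    ← LinearMap.det_toMatrix (EuclideanSpace.basisFun (Fin 2) ℝ).toBasis, Matrix.det_fin_two]
  simp [LinearMap.toMatrix_apply, latticeMap_apply]

lemma injective_latticeMap (hb : b ≠ 0) : Function.Injective (latticeMap a b) := by
  intro p q h
  rw [latticeMap_apply, latticeMap_apply] at h
  have h1 := congrArg (fun v : Plane => v 1) h
  have h2 := congrArg (fun v : Plane => v 0) h
  simp [hb] at h1 h2
  rw [h1] at h2
  rw [← vec_eta p, ← vec_eta q, h1, add_right_cancel h2]

/-- The measurable equivalence of the plane with `ℝ × ℝ`. -/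
def planeEquiv : Plane ≃ᵐ ℝ × ℝ :=
  (MeasurableEquiv.toLp 2 (Fin 2 → ℝ)).symm.trans MeasurableEquiv.finTwoArrow

lemma planeEquiv_apply (p : Plane) : planeEquiv p = (p 0, p 1) := rfl

lemma measurePreserving_planeEquiv : MeasurePreserving planeEquiv :=
  (volume_preserving_finTwoArrow ℝ).comp
    (EuclideanSpace.volume_preserving_symm_measurableEquiv_toLp (Fin 2))

lemma fundamentalParallelogram_eq_image : fundamentalParallelogram a b =
    latticeMap a b '' (planeEquiv ⁻¹' (Set.Ico (0 : ℝ) 1 ×ˢ Set.Ico (0 : ℝ) 1)) := by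
  ext p
  constructor
  · rintro ⟨s, hs, t, ht, rfl⟩
    exact ⟨!₂[s, t], ⟨hs, ht⟩, by simp [latticeMap_apply]⟩
  · rintro ⟨q, ⟨hs, ht⟩, rfl⟩
    exact ⟨q 0, hs, q 1, ht, latticeMap_apply q⟩

lemma integral_fundamentalParallelogram (hb : b ≠ 0) (φ : ℝ → ℝ) :
    ∫ p in fundamentalParallelogram a b, φ (2 * Real.pi / b * p 1) =
      |b| / (2 * Real.pi) * ∫ t in (0 : ℝ)..2 * Real.pi, φ t := by
  have hmeas : MeasurableSet (planeEquiv ⁻¹' (Set.Ico (0 : ℝ) 1 ×ˢ Set.Ico (0 : ℝ) 1)) :=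
    planeEquiv.measurable (measurableSet_Ico.prod measurableSet_Ico)
  rw [fundamentalParallelogram_eq_image, integral_image_eq_integral_abs_det_fderiv_smul volume
    hmeas (fun p _ => (latticeMap a b).hasFDerivAt.hasFDerivWithinAt)
    (injective_latticeMap hb).injOn]
  have e : ∀ p : Plane, |(latticeMap a b).det| • φ (2 * Real.pi / b * (latticeMap a b p) 1) =
      (fun z : ℝ × ℝ => |b| * φ (2 * Real.pi * z.2)) (planeEquiv p) := fun p => by
    rw [det_latticeMap, latticeMap_apply, planeEquiv_apply]
    simp only [smul_eq_mul]
    congr 2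
    simp
    field_simp
  simp only [e]
  rw [measurePreserving_planeEquiv.setIntegral_preimage_emb planeEquiv.measurableEmbedding
    (fun z : ℝ × ℝ => |b| * φ (2 * Real.pi * z.2)),
    Measure.volume_eq_prod]
  have h := setIntegral_prod_mul (μ := (volume : Measure ℝ)) (ν := (volume : Measure ℝ))
    (fun _ : ℝ => |b|) (fun t : ℝ => φ (2 * Real.pi * t)) (Set.Ico 0 1) (Set.Ico 0 1)
  rw [h, setIntegral_const, integral_Ico_eq_integral_Ioc,
    ← intervalIntegral.integral_of_le zero_le_one,
    intervalIntegral.integral_comp_mul_left _ (by positivity)]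
  simp
  ring

end Area

/-! ### Comparison with the flat metric -/

/-- The metric `e^{2w} g` for the flat metric `g`. -/
def conformalMetric (w : Torus a b → ℝ) (hw : IsSmooth w) : Metric a b where
  coeff := fun x => Real.exp (2 * w x) • 1
  posDef := fun _ => Matrix.PosDef.one.smul (Real.exp_pos _)
  smooth := fun _ _ => (Real.contDiff_exp.comp (contDiff_const.mul hw)).mul contDiff_const

lemma area_of_profile {g : Metric a b} {r : Torus a b → ℝ} {ε : ℝ} (hb : b ≠ 0)
    (hg : ∀ x, g.coeff x = r x • (1 : Matrix (Fin 2) (Fin 2) ℝ)) (hr : ∀ x, 0 < r x)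
    (hlift : ∀ p, lift r p = profile ε (2 * Real.pi / b * p 1)) :
    area g = |b| / (2 * Real.pi) * ∫ t in (0 : ℝ)..2 * Real.pi, profile ε t := by
  simp only [area, density_of_coeff_eq_smul hg hr, hlift]
  exact integral_fundamentalParallelogram hb (profile ε)

lemma profile_zero (t : ℝ) : profile 0 t = 1 := by
  simp [profile, diffeoDeriv, logDeriv₁, logDeriv₂]

/-- The dual lattice vectors not orthogonal to `(1, 0)` are uniformly longer than the shortest. -/
lemma dual_gap (ha₀ : 0 ≤ a) (ha₁ : a ≤ 1 / 2) (hab : 1 < a ^ 2 + b ^ 2) {δ : ℝ}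
    (hδ : 1 + δ ≤ a ^ 2 + b ^ 2) (hδ2 : δ ≤ 1) (m n : ℤ) (hm : m ≠ 0) :
    1 + δ ≤ (m : ℝ) ^ 2 * b ^ 2 + (n - m * a) ^ 2 := by
  have hb : 3 / 4 ≤ b ^ 2 := by nlinarith
  -- As `0 ≤ a ≤ 1/2`, no integer is closer to `a` than `0`; this settles `m = ±1`.
  have hunit : ∀ k : ℤ, a ^ 2 ≤ ((k : ℝ) - a) ^ 2 := fun k => by
    rcases le_or_gt k 0 with hk | hk
    · have : (k : ℝ) ≤ 0 := by exact_mod_cast hk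
      nlinarith
    · have : (1 : ℝ) ≤ k := by exact_mod_cast hk
      nlinarith
  by_cases h1 : m = 1
  · subst h1
    have := hunit n
    push_cast
    linarith
  by_cases h2 : m = -1
  · subst h2
    have := hunit (-n)
    push_cast at this ⊢
    nlinarith
  -- For `|m| ≥ 2` the first term alone is at least `4 · 3/4 = 3`, which exceeds `1 + δ`.
  · have : (4 : ℤ) ≤ m ^ 2 := by
      have : 2 ≤ |m| := by
        by_contra! h
        have := abs_lt.1 h
        omega
      nlinarith [sq_abs m]
    have : (4 : ℝ) ≤ (m : ℝ) ^ 2 := by exact_mod_cast this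
    nlinarith [sq_nonneg ((n : ℝ) - m * a)]

end FlatTorus

end

theorem theorem1p1 (a b : ℝ) (ha₀ : 0 ≤ a) (ha₁ : a ≤ 1 / 2) (hab : 1 < a ^ 2 + b ^ 2) :
    ¬ FlatTorus.IsConformallyMaximal (FlatTorus.flatMetric a b) := by
  open FlatTorus in
  have hb : b ≠ 0 := by
    rintro rfl
    nlinarith
  -- The bound `1/10` serves the pointwise estimates on the profile; the other keeps `1 + 4ε` below
  -- the modes depending on `x`.
  obtain ⟨ε, hε0, hε1, hε2⟩ : ∃ ε : ℝ, 0 < ε ∧ ε ≤ 1 / 10 ∧ 1 + 4 * ε ≤ a ^ 2 + b ^ 2 :=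
    ⟨min (1 / 10) ((a ^ 2 + b ^ 2 - 1) / 4), lt_min (by norm_num) (by linarith),
      min_le_left _ _, by linarith [min_le_right (1 / 10) ((a ^ 2 + b ^ 2 - 1) / 4)]⟩
  have hpos := profile_pos hε0.le hε1
  have hsmooth := contDiff_profile (ε := ε) hε0.le (by linarith) (n := ∞)
  set φ : ℝ → ℝ := fun t => Real.log (profile ε t) / 2 with hφ
  have hφs : ContDiff ℝ ∞ φ := (hsmooth.log fun t => (hpos t).ne').div_const 2
  have hφp : Function.Periodic φ (2 * Real.pi) := fun t => by
    simp only [hφ, periodic_profile t]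
  set w : Torus a b → ℝ := descend (fun p => φ (2 * Real.pi / b * p 1)) with hw
  have hlw : lift w = fun p => φ (2 * Real.pi / b * p 1) := lift_descend_snd hb hφp
  have hws : IsSmooth w := by
    rw [IsSmooth, hlw]
    exact contDiff_comp_snd hφs _
  have hlift : ∀ p, lift (fun x => Real.exp (2 * w x)) p = profile ε (2 * Real.pi / b * p 1) := by
    intro p
    have h : w (QuotientAddGroup.mk p) = φ (2 * Real.pi / b * p 1) := congrFun hlw p
    rw [lift, h, hφ]
    simp only
    rw [mul_div_cancel₀ _ (two_ne_zero), Real.exp_log (hpos _)]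
  have hg : ∀ x, (conformalMetric w hws).coeff x =
      Real.exp (2 * w x) • (1 : Matrix (Fin 2) (Fin 2) ℝ) := fun _ => rfl
  have hflat : ∀ x, (flatMetric a b).coeff x = (1 : ℝ) • (1 : Matrix (Fin 2) (Fin 2) ℝ) :=
    fun _ => (one_smul _ _).symm
  have hflat_lift : ∀ p, lift (fun _ : Torus a b => (1 : ℝ)) p =
      profile 0 (2 * Real.pi / b * p 1) := fun p => (profile_zero _).symm
  have hk : 0 < (2 * Real.pi / b) ^ 2 := by
    have := Real.pi_pos
    positivity
  intro hmax
  have h := hmax (conformalMetric w hws) ⟨w, hws, fun _ => rfl⟩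
  -- Only an upper bound is needed on the flat side.
  have hupper : lambdaOne (flatMetric a b) ≤ (2 * Real.pi / b) ^ 2 :=
    csInf_le ⟨0, fun μ hμ => hμ.1.le⟩
      ⟨hk, isEigenvalue_of_profile le_rfl (by norm_num) hb hflat (fun _ => one_pos) hflat_lift⟩
  -- Exhibiting an eigenvalue matters: the infimum of an empty set of reals is `0` by convention.
  have hlower : (2 * Real.pi / b) ^ 2 ≤ lambdaOne (conformalMetric w hws) :=
    le_csInf ⟨_, hk, isEigenvalue_of_profile hε0.le hε1 hb hg (fun _ => Real.exp_pos _) hlift⟩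
      fun μ hμ => eigenvalue_ge_of_profile hε0.le hε1 hb
        (fun m n hm => dual_gap ha₀ ha₁ hab hε2 (by linarith) m n hm) hg
        (fun _ => Real.exp_pos _) hlift hμ.1 hμ.2
  have hA := area_of_profile hb hg (fun _ => Real.exp_pos _) hlift
  have hA0 : area (flatMetric a b) = |b| := by
    rw [area_of_profile hb hflat (fun _ => one_pos) hflat_lift]
    have := Real.pi_pos.ne'
    simp only [profile_zero, intervalIntegral.integral_const, smul_eq_mul]
    field_simp
    ring
  have hAgt : |b| < area (conformalMetric w hws) := by
    have hπ := Real.pi_pos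
    have hb' := abs_pos.2 hb
    rw [hA]
    calc |b| = |b| / (2 * Real.pi) * (2 * Real.pi) := by field_simp
      _ < _ := mul_lt_mul_of_pos_left (integral_profile_gt hε0 hε1) (by positivity)
  rw [lambdaBarOne, lambdaBarOne, hA0] at h
  have hb' := abs_pos.2 hb
  have h1 := mul_le_mul_of_nonneg_right hupper hb'.le
  have h2 := mul_lt_mul_of_pos_left hAgt hk
  have h3 := mul_le_mul_of_nonneg_right hlower (hb'.trans hAgt).le
  linarith
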